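/- Identify the natural numbers with $\{0,1\}^*$ via $0\mapsto\epsilon,\ 1\mapsto 0,\ 2\mapsto 1,\ 3\mapsto 00,\dots$, write $l(z)$ for the length of a string $z$ and $\log$ for the logarithm to base $2$. A prefix machine is a partial recursive function $T$ from $\{0,1\}^*$ to $\{0,1\}^*$ whose domain is prefix-free. A prefix machine $U$ is universal if for every prefix machine $T$ there are a constant $c_T$ and an encoding $y\mapsto\langle T,y\rangle\in\{0,1\}^*$ with $l(\langle T,y\rangle)\le l(y)+c_T$ and $U(\langle T,y\rangle)=T(y)$ for all $y$ (both sides may be undefined). Let $K(x)=\min\{l(z):U(z)=x\}$ be the prefix Kolmogorov complexity of $x\in\{0,1\}^*$ relative to $U$. Let $T_0,T_1,\dots$ be a standard enumeration of the machines computing all partial recursive functions. $T_i$ computes a function $g:\{0,1\}^*\to\mathbb R$ if on every input $\langle x,y\rangle$ with $x\in\{0,1\}^*$ and $y\ge 1$ it halts and outputs natural numbers $p,q$ with $q>0$ and $|p/q-|g(x)||<1/y$, together with a bit for the sign of $g(x)$ (either bit being allowed if $g(x)=0$). The function $g$ is computable if some $T_i$ computes it, and then $K(g)=\min\{K(i):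 T_i\text{ computes }g\}$. Theorem. For every universal prefix machine $U$ there is a constant $C$, depending only on $U$ (and on the fixed enumeration), such that for every computable probability mass function $f$ on $\{0,1\}^*$, with entropy $H(X)=\sum_x f(x)\log\frac1{f(x)}$ (where $0\log\frac10=0$), the following holds in $[0,\infty]$: $$H(X)\;\le\;\sum_x f(x)K(x)\;\le\;H(X)+K(f)+C .$$ In particular, if $H(X)<\infty$, then $\sum_x f(x)K(x)$ and $K(f)$ are finite and $$0\;\le\;\sum_x f(x)K(x)-H(X)\;\le\;K(f)+C .$$ -/

import Mathlib

open scoped ENNReal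

namespace AlgInfo

/-- The standard bijection `0 ↦ ε, 1 ↦ 0, 2 ↦ 1, 3 ↦ 00, 4 ↦ 01, …` between natural numbers and
binary strings: write `n + 1` in binary, most significant bit first, and drop the leading `1`. -/
def natToString (n : ℕ) : List Bool :=
  (n + 1).bits.dropLast.reverse

/-- The partial recursive function computed by the `i`-th machine, in the standard enumeration of
all (codes of) partial recursive functions. -/
def machine (i : ℕ) : ℕ →. ℕ :=
  (Denumerable.ofNat Nat.Partrec.Code i).eval

/-- The `i`-th machine computes the real-valued function `g`: on input `⟨x, y⟩` with `y ≥ 1` it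
halts, and outputs a fraction `p / q` with `|p / q - |g x|| < 1 / y` together with a bit
for the sign of `g x` (either bit is allowed if `g x = 0`). -/
def ComputesReal (i : ℕ) (g : List Bool → ℝ) : Prop :=
  ∀ (x : List Bool) (y : ℕ), 0 < y → ∃ (p q : ℕ) (b : Bool),
    Encodable.encode ((p, q), b) ∈ machine i (Encodable.encode (x, y)) ∧
    0 < q ∧ |(p : ℝ) / (q : ℝ) - abs (g x)| < 1 / (y : ℝ) ∧
    g x = if b then abs (g x) else -abs (g x)

/-- A (total) real-valued function on binary strings is computable. -/
def IsComputableReal (g : List Bool → ℝ) : Prop :=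
  ∃ i : ℕ, ComputesReal i g

/-- A prefix machine, as a function from programs to outputs: a partial recursive function on
binary strings whose set of halting programs is prefix-free. -/
structure IsPrefixMachine (T : List Bool →. List Bool) : Prop where
  partrec : Partrec T
  prefixFree : ∀ y z : List Bool, (T y).Dom → (T z).Dom → y <+: z → y = z

/-- A universal prefix machine: a prefix machine `U` that simulates every prefix machine `T` on
encoded programs, `U ⟨T, y⟩ = T y`, where the encoding `y ↦ ⟨T, y⟩` adds at most a constant
number of bits (depending on `T` only). -/
structure IsUniversalPrefixMachine (U : List Bool →. List Bool) : Prop where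
  isPrefixMachine : IsPrefixMachine U
  simulates : ∀ T : List Bool →. List Bool, IsPrefixMachine T →
    ∃ (e : List Bool → List Bool) (c : ℕ),
      (∀ y, (e y).length ≤ y.length + c) ∧ ∀ y, U (e y) = T y

/-- `K(x)`: the length of a shortest program for `x` on `U` (`⊤` if there is none). -/
noncomputable def K (U : List Bool →. List Bool) (x : List Bool) : ℕ∞ :=
  ⨅ (z : List Bool) (_ : x ∈ U z), (z.length : ℕ∞)

/-- `K(g)` for a real-valued function `g`: the least `K(i)` over all `i` such that the `i`-th
machine computes `g` (`⊤` if `g` is not computable). -/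
noncomputable def KReal (U : List Bool →. List Bool) (g : List Bool → ℝ) : ℕ∞ :=
  ⨅ (i : ℕ) (_ : ComputesReal i g), K U (natToString i)

/-- The mass function as a real-valued function. -/
noncomputable def mass (f : PMF (List Bool)) (x : List Bool) : ℝ :=
  (f x).toReal

/-- The entropy `∑ₓ f(x) log₂ (1 / f(x))` in bits, with value in `[0, ∞]`; terms with `f(x) = 0`
vanish. -/
noncomputable def entropy (f : PMF (List Bool)) : ℝ≥0∞ :=
  ∑' x, f x * ENNReal.ofReal (Real.logb 2 (1 / mass f x))

/-- The expected complexity `∑ₓ f(x) K(x)`, with value in `[0, ∞]`. -/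
noncomputable def expectedK (U : List Bool →. List Bool) (f : PMF (List Bool)) : ℝ≥0∞ :=
  ∑' x, f x * (K U x : ℝ≥0∞)

end AlgInfo

/-!
The lower bound is the noiseless coding inequality. Choosing a shortest program for every string
gives a prefix-free set, so `∑ 2 ^ (-K x) ≤ 1` by Kraft's inequality, and summing Gibbs' inequality
`f log (1 / f) + f / log 2 ≤ f K + 2 ^ (-K) / log 2` over all strings gives `H ≤ ∑ f K`
(`entropy_le_expectedK`).

The upper bound holds pointwise: `K x ≤ log (1 / f x) + K f + C` whenever `f x ≠ 0`
(`exists_K_le_log_add`). A decoder, which is a prefix machine, reads a `U`-program for the index of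
a machine computing `f` and then a code word for `x` (`exists_decoder`). The code words form an
online variant of the Shannon–Fano–Elias code that works uniformly in the machine. The stages
`⟨k, n, t⟩` run the machine on the string encoded by `k` with precision `2 ^ (-n)` for `t + 1`
steps, and a code word is requested once the run has just halted and certifies that
`2 * 2 ^ (-n) < f x`. The request takes the next free interval of length `2 ^ (-n)` of the real
line, and its code word of length `n + 1` is a dyadic interval inside. Intervals of different
requests are disjoint whatever the machine does, so the code is prefix-free even for indices of
machines that compute nothing (`IsCodeWord.eq_of_prefix`). If the machine does compute `f`, the
requests for `x` have total weight at most `f x` (`ComputesReal.tsum_weight_le`), so all of them fit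
into the unit interval, and the shortest one for `x` has length at most `log (1 / f x) + 4`
(`exists_short_codeWord`).

Everything the decoder checks is primitive recursive once a bound on the number of steps of `U` is
part of the search, so that the decoder is obtained from a primitive recursive relation by unbounded
search (`exists_prefixMachine`).
-/

namespace AlgInfo

open Encodable
open Nat.Partrec (Code)

/-! ### Binary strings as dyadic intervals -/

/-- The number whose binary expansion is `1w`, most significant bit first. -/
def strVal (w : List Bool) : ℕ :=
  w.foldl (fun a b => 2 * a + b.toNat) 1

theorem strVal_concat (w : List Bool) (b : Bool) : strVal (w ++ [b]) = 2 * strVal w + b.toNat := by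
  simp [strVal]

theorem strVal_natToString (n : ℕ) : strVal (natToString n) = n + 1 := by
  have key : ∀ m : ℕ, m ≠ 0 → strVal m.bits.dropLast.reverse = m := by
    intro m
    induction m using Nat.binaryRec' with
    | zero => intro h; exact absurd rfl h
    | bit b n h ih =>
      intro hn
      rw [Nat.bits_append_bit n b h]
      rcases Nat.eq_zero_or_pos n with rfl | hpos
      · simp [h rfl, strVal]
      · have hne : n.bits ≠ [] := by
          intro h0
          have h1 := ih hpos.ne'
          rw [h0] at h1
          obtain rfl : 1 = n := by simpa [strVal] using h1
          simp at h0
        rw [List.dropLast_cons_of_ne_nil hne, List.reverse_cons, strVal_concat, ih hpos.ne',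
          Nat.bit_val]
  exact key (n + 1) n.succ_ne_zero

/-- The dyadic interval `[strVal u, strVal u + 1) / 2 ^ |u|` contains that of every extension of
`u`. -/
theorem strVal_append_mem_Ico (u v : List Bool) :
    strVal u * 2 ^ v.length ≤ strVal (u ++ v) ∧
      strVal (u ++ v) < (strVal u + 1) * 2 ^ v.length := by
  induction v using List.reverseRecOn with
  | nil => simp
  | append_singleton v b ih =>
    rw [← List.append_assoc, strVal_concat, List.length_append, List.length_singleton, pow_succ]
    have : b.toNat ≤ 1 := Bool.toNat_le b
    constructor <;> nlinarith [ih.1, ih.2]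

theorem exists_strVal_eq (n m : ℕ) (h₁ : 2 ^ n ≤ m) (h₂ : m < 2 ^ (n + 1)) :
    ∃ w : List Bool, w.length = n ∧ strVal w = m := by
  induction n generalizing m with
  | zero => exact ⟨[], rfl, by simp [strVal] at *; omega⟩
  | succ n ih =>
    obtain ⟨w, hw, hv⟩ := ih (m / 2) (by rw [pow_succ] at h₁; omega) (by rw [pow_succ] at h₂; omega)
    refine ⟨w ++ [decide (m % 2 = 1)], by simp [hw], ?_⟩
    rw [strVal_concat, hv]
    rcases Nat.mod_two_eq_zero_or_one m with h | h <;> simp [h] <;> omega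

theorem strVal_primrec : Primrec strVal := by
  refine Primrec.list_foldl (h := fun _ p => 2 * p.1 + p.2.toNat) (Primrec.id (α := List Bool))
    (Primrec.const 1) ?_
  exact Primrec.nat_add.comp
    (Primrec.nat_double.comp (Primrec.fst.comp Primrec.snd))
    ((Primrec.dom_finite Bool.toNat).comp (Primrec.snd.comp Primrec.snd))

theorem two_pow_primrec : Primrec fun n : ℕ => 2 ^ n := by
  refine (Primrec.nat_rec₁ (f := fun _ a => 2 * a) 1 ?_).of_eq fun n => ?_
  · exact Primrec.nat_double.comp Primrec.snd
  · induction n with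
    | zero => rfl
    | succ n ih => rw [pow_succ, mul_comm, ← ih]

/-! ### Machines given by an enumeration of their graph -/

/-- A function whose graph is the projection of a primitive recursive relation, and whose domain is
prefix-free, is a prefix machine: search for a witness. -/
theorem exists_prefixMachine {α : Type*} [Primcodable α]
    (R : α × List Bool × List Bool → Prop) (hR : PrimrecPred R)
    (h : ∀ a y x a' y' x', R (a, y, x) → R (a', y', x') → y <+: y' → y = y' ∧ x = x') :
    ∃ T, IsPrefixMachine T ∧ ∀ y x, x ∈ T y ↔ ∃ a, R (a, y, x) := by
  classical
  let g : List Bool → ℕ → Option (List Bool) := fun y m =>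
    (decode (α := α × List Bool) m).bind fun a => if R (a.1, y, a.2) then some a.2 else none
  have hg : Primrec₂ g := by
    refine Primrec.option_bind (Primrec.decode.comp Primrec.snd) ?_
    refine Primrec.ite (hR.comp ?_) (Primrec.option_some.comp (Primrec.snd.comp Primrec.snd))
      (Primrec.const none)
    exact (Primrec.fst.comp Primrec.snd).pair
      ((Primrec.fst.comp Primrec.fst).pair (Primrec.snd.comp Primrec.snd))
  have hmem : ∀ y m x, x ∈ g y m → ∃ a, R (a, y, x) := by
    intro y m x hx
    simp only [g, Option.mem_def, Option.bind_eq_some_iff] at hx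
    obtain ⟨a, -, ha⟩ := hx
    split_ifs at ha with hRa
    obtain rfl : a.2 = x := by simpa using ha
    exact ⟨_, hRa⟩
  have hT : ∀ y x, x ∈ Nat.rfindOpt (g y) ↔ ∃ a, R (a, y, x) := by
    intro y x
    refine ⟨fun hx => ?_, fun ⟨a, ha⟩ => ?_⟩
    · obtain ⟨m, hm⟩ := Nat.rfindOpt_spec hx
      exact hmem y m x hm
    · have hdom : (Nat.rfindOpt (g y)).Dom :=
        Nat.rfindOpt_dom.2 ⟨encode (a, x), x, by simp [g, ha]⟩
      obtain ⟨m, hm⟩ := Nat.rfindOpt_spec (Part.get_mem hdom)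
      obtain ⟨a', ha'⟩ := hmem y m _ hm
      rw [(h _ _ _ _ _ _ ha ha' (List.prefix_refl y)).2]
      exact Part.get_mem hdom
  refine ⟨fun y => Nat.rfindOpt (g y), ⟨Partrec.rfindOpt hg.to_comp, fun y z hy hz hyz => ?_⟩, hT⟩
  obtain ⟨a, ha⟩ := (hT y _).1 (Part.get_mem hy)
  obtain ⟨b, hb⟩ := (hT z _).1 (Part.get_mem hz)
  exact (h _ _ _ _ _ _ ha hb hyz).1

/-! ### Requests extracted from a machine -/

/-- The precision exponent `n` of the stage `s = ⟨k, n, t⟩`. -/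
def stageExp (s : ℕ) : ℕ := s.unpair.2.unpair.1

/-- The run of the code `c` for `t` steps on the input `⟨k, 2 ^ n⟩`, where `s = ⟨k, n, _⟩`. -/
def stageRun (c : Code) (s t : ℕ) : Option ℕ :=
  c.evaln t (Nat.pair s.unpair.1 (2 ^ stageExp s))

/-- At the stage `s = ⟨k, n, t⟩`, a code word of length `n + 1` is requested for the string encoded
by `k`: the code `c` halts on `⟨k, 2 ^ n⟩` after exactly `t + 1` steps, and the fraction `p / q` it
outputs satisfies `3 / 2 ^ n ≤ p / q`. Counting the steps exactly makes `t` unique given `k` and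
`n`. -/
def IsRequest (c : Code) (s : ℕ) : Prop :=
  encode (decode (α := List Bool) s.unpair.1) = s.unpair.1 + 1 ∧
    stageRun c s s.unpair.2.unpair.2 = none ∧
    (stageRun c s (s.unpair.2.unpair.2 + 1)).isSome = true ∧
    3 * ((stageRun c s (s.unpair.2.unpair.2 + 1)).getD 0).unpair.1.unpair.2 ≤
      ((stageRun c s (s.unpair.2.unpair.2 + 1)).getD 0).unpair.1.unpair.1 * 2 ^ stageExp s

instance (c : Code) (s : ℕ) : Decidable (IsRequest c s) :=
  inferInstanceAs (Decidable (_ ∧ _ ∧ _ ∧ _))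

/-- `cumWeight c s / 2 ^ s` is one plus the total weight `2 ^ (-n)` of the requests before stage
`s`. The offset one matches the leading digit in `strVal`. -/
def cumWeight (c : Code) (s : ℕ) : ℕ :=
  s.rec 1 fun r a => 2 * a + if IsRequest c r then 2 ^ (r + 1 - stageExp r) else 0

theorem cumWeight_succ (c : Code) (s : ℕ) : cumWeight c (s + 1) =
    2 * cumWeight c s + if IsRequest c s then 2 ^ (s + 1 - stageExp s) else 0 := rfl

/-- `w` is the code word given to the request at stage `s`: of the dyadic intervals of length
`2 ^ (-(n + 1))`, it is the first one that starts at or after the cumulative weight. -/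
def IsCodeWord (c : Code) (s : ℕ) (w : List Bool) : Prop :=
  IsRequest c s ∧ w.length = stageExp s + 1 ∧
    cumWeight c s * 2 ^ (stageExp s + 1) ≤ strVal w * 2 ^ s ∧
    strVal w * 2 ^ s < cumWeight c s * 2 ^ (stageExp s + 1) + 2 ^ s

theorem stageExp_le (s : ℕ) : stageExp s ≤ s :=
  (Nat.unpair_left_le _).trans (Nat.unpair_right_le _)

theorem unpair_fst_primrec : Primrec fun s : ℕ => s.unpair.1 := Primrec.fst.comp Primrec.unpair

theorem unpair_snd_primrec : Primrec fun s : ℕ => s.unpair.2 := Primrec.snd.comp Primrec.unpair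

theorem stageExp_primrec : Primrec stageExp := unpair_fst_primrec.comp unpair_snd_primrec

theorem isRequest_primrec : PrimrecRel IsRequest := by
  have hs : Primrec fun p : Code × ℕ => p.2 := Primrec.snd
  have ht : Primrec fun p : Code × ℕ => p.2.unpair.2.unpair.2 :=
    unpair_snd_primrec.comp (unpair_snd_primrec.comp hs)
  have hpow : Primrec fun p : Code × ℕ => 2 ^ stageExp p.2 :=
    two_pow_primrec.comp (stageExp_primrec.comp hs)
  have hrun : ∀ f : Code × ℕ → ℕ, Primrec f → Primrec fun p => stageRun p.1 p.2 (f p) :=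
    fun f hf => Code.primrec_evaln.comp ((hf.pair Primrec.fst).pair
      (Primrec₂.natPair.comp (unpair_fst_primrec.comp hs) hpow))
  have hout : Primrec fun p : Code × ℕ =>
      ((stageRun p.1 p.2 (p.2.unpair.2.unpair.2 + 1)).getD 0).unpair.1 :=
    unpair_fst_primrec.comp
      (Primrec.option_getD.comp (hrun _ (Primrec.succ.comp ht)) (Primrec.const 0))
  refine PrimrecPred.and ?_ (PrimrecPred.and ?_ (PrimrecPred.and ?_ ?_))
  · exact Primrec.eq.comp (Primrec.encode.comp
      ((Primrec.decode (α := List Bool)).comp (unpair_fst_primrec.comp hs)))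
      (Primrec.succ.comp (unpair_fst_primrec.comp hs))
  · exact Primrec.eq.comp (hrun _ ht) (Primrec.const none)
  · exact Primrec.eq.comp (Primrec.option_isSome.comp (hrun _ (Primrec.succ.comp ht)))
      (Primrec.const true)
  · exact Primrec.nat_le.comp
      (Primrec.nat_mul.comp (Primrec.const 3) (unpair_snd_primrec.comp hout))
      (Primrec.nat_mul.comp (unpair_fst_primrec.comp hout) hpow)

theorem cumWeight_primrec : Primrec₂ cumWeight := by
  refine Primrec.nat_rec (f := fun _ : Code => 1) (g := fun c (p : ℕ × ℕ) =>
    2 * p.2 + if IsRequest c p.1 then 2 ^ (p.1 + 1 - stageExp p.1) else 0) (Primrec.const 1) ?_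
  have hr : Primrec fun a : Code × ℕ × ℕ => a.2.1 := Primrec.fst.comp Primrec.snd
  refine Primrec.nat_add.comp (Primrec.nat_double.comp (Primrec.snd.comp Primrec.snd)) ?_
  refine Primrec.ite (isRequest_primrec.comp Primrec.fst hr) ?_ (Primrec.const 0)
  exact two_pow_primrec.comp
    (Primrec.nat_sub.comp (Primrec.succ.comp hr) (stageExp_primrec.comp hr))

theorem isCodeWord_primrec :
    PrimrecPred fun p : Code × ℕ × List Bool => IsCodeWord p.1 p.2.1 p.2.2 := by
  have hc : Primrec fun p : Code × ℕ × List Bool => p.1 := Primrec.fst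
  have hs : Primrec fun p : Code × ℕ × List Bool => p.2.1 := Primrec.fst.comp Primrec.snd
  have hw : Primrec fun p : Code × ℕ × List Bool => p.2.2 := Primrec.snd.comp Primrec.snd
  have hn : Primrec fun p : Code × ℕ × List Bool => stageExp p.2.1 + 1 :=
    Primrec.succ.comp (stageExp_primrec.comp hs)
  have hv := Primrec.nat_mul.comp (strVal_primrec.comp hw) (two_pow_primrec.comp hs)
  have hcum := Primrec.nat_mul.comp (cumWeight_primrec.comp hc hs) (two_pow_primrec.comp hn)
  exact (isRequest_primrec.comp hc hs).and ((Primrec.eq.comp (Primrec.list_length.comp hw) hn).and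
    ((Primrec.nat_le.comp hcum hv).and
      (Primrec.nat_lt.comp hv (Primrec.nat_add.comp hcum (two_pow_primrec.comp hs)))))

/-! ### The code words are prefix-free -/

/-- The real number `cumWeight c s / 2 ^ s`. -/
noncomputable def cumReal (c : Code) (s : ℕ) : ℝ := cumWeight c s / 2 ^ s

theorem cumReal_succ (c : Code) (s : ℕ) : cumReal c (s + 1) =
    cumReal c s + if IsRequest c s then (1 / 2 : ℝ) ^ stageExp s else 0 := by
  have h := stageExp_le s
  rw [cumReal, cumReal, cumWeight_succ]
  split_ifs
  · have h2 : (2 : ℝ) ^ (s + 1) = 2 ^ (s + 1 - stageExp s) * 2 ^ stageExp s := by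
      rw [← pow_add]; congr 1; omega
    push_cast
    rw [add_div, one_div, inv_pow]
    congr 1
    · rw [pow_succ]; field_simp
    · rw [h2]; field_simp
  · push_cast
    rw [pow_succ]; field_simp; ring

theorem cumReal_mono (c : Code) : Monotone (cumReal c) := by
  refine monotone_nat_of_le_succ fun s => ?_
  rw [cumReal_succ]
  split_ifs
  · exact le_add_of_nonneg_right (by positivity)
  · simp

/-- The dyadic interval of a code word lies in the interval of its request. -/
theorem IsCodeWord.interval {c : Code} {s : ℕ} {w : List Bool} (h : IsCodeWord c s w) :
    cumReal c s ≤ strVal w / 2 ^ w.length ∧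
      ((strVal w : ℝ) + 1) / 2 ^ w.length < cumReal c (s + 1) := by
  obtain ⟨hr, hl, h1, h2⟩ := h
  have h1' : (cumWeight c s * 2 ^ (stageExp s + 1) : ℝ) ≤ strVal w * 2 ^ s := by exact_mod_cast h1
  have h2' : (strVal w * 2 ^ s : ℝ) < cumWeight c s * 2 ^ (stageExp s + 1) + 2 ^ s := by
    exact_mod_cast h2
  have hp : (0 : ℝ) < 2 ^ s := by positivity
  have hq : (0 : ℝ) < 2 ^ (stageExp s + 1) := by positivity
  rw [cumReal_succ, if_pos hr, hl]
  constructor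
  · rw [cumReal, div_le_div_iff₀ hp hq]; exact h1'
  · have e : (1 / 2 : ℝ) ^ stageExp s = 2 / 2 ^ (stageExp s + 1) := by
      rw [pow_succ, one_div, inv_pow]; field_simp
    have h3 : (strVal w : ℝ) / 2 ^ (stageExp s + 1) < cumReal c s + 1 / 2 ^ (stageExp s + 1) := by
      rw [cumReal, div_add_div _ _ hp.ne' hq.ne', div_lt_div_iff₀ hq (by positivity)]
      nlinarith
    have h4 : (2 : ℝ) / 2 ^ (stageExp s + 1) =
        1 / 2 ^ (stageExp s + 1) + 1 / 2 ^ (stageExp s + 1) := by ring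
    rw [e, add_div]
    linarith

/-- Code words of different stages have disjoint intervals, so neither extends the other. -/
theorem IsCodeWord.eq_of_prefix {c : Code} {s s' : ℕ} {w w' : List Bool}
    (h : IsCodeWord c s w) (h' : IsCodeWord c s' w') (hp : w <+: w') : w = w' ∧ s = s' := by
  obtain ⟨v, rfl⟩ := hp
  obtain ⟨i1, i2⟩ := h.interval
  obtain ⟨j1, j2⟩ := h'.interval
  obtain ⟨k1, k2⟩ := strVal_append_mem_Ico w v
  have k1' : (strVal w * 2 ^ v.length : ℝ) ≤ strVal (w ++ v) := by exact_mod_cast k1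
  have k2' : (strVal (w ++ v) + 1 : ℝ) ≤ (strVal w + 1) * 2 ^ v.length := by exact_mod_cast k2
  have l1 : (strVal w : ℝ) / 2 ^ w.length ≤ strVal (w ++ v) / 2 ^ (w ++ v).length := by
    rw [List.length_append, pow_add, div_le_div_iff₀ (by positivity) (by positivity)]
    nlinarith [pow_pos (two_pos (α := ℝ)) w.length]
  have l2 : ((strVal (w ++ v) : ℝ) + 1) / 2 ^ (w ++ v).length ≤ (strVal w + 1) / 2 ^ w.length := by
    rw [List.length_append, pow_add, div_le_div_iff₀ (by positivity) (by positivity)]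
    nlinarith [pow_pos (two_pos (α := ℝ)) w.length]
  have l3 : (strVal (w ++ v) : ℝ) / 2 ^ (w ++ v).length <
      (strVal (w ++ v) + 1) / 2 ^ (w ++ v).length := by
    gcongr; linarith
  have hs : s = s' := by
    rcases lt_trichotomy s s' with hlt | heq | hgt
    · have := cumReal_mono c (Nat.succ_le_of_lt hlt)
      simp only [Nat.succ_eq_add_one] at this
      linarith
    · exact heq
    · have := cumReal_mono c (Nat.succ_le_of_lt hgt)
      simp only [Nat.succ_eq_add_one] at this
      linarith
  subst hs
  have hlen := h'.2.1.trans h.2.1.symm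
  have : v = [] := by
    rw [List.length_append] at hlen
    exact List.length_eq_zero_iff.1 (by omega)
  simp [this]

/-- If the weights up to stage `s` sum to at most one, the request at stage `s` is served. -/
theorem exists_isCodeWord {c : Code} {s : ℕ} (hr : IsRequest c s) (h : cumReal c (s + 1) ≤ 2) :
    ∃ w, IsCodeWord c s w := by
  have hp : (0 : ℝ) < 2 ^ s := by positivity
  have h0 : (1 : ℝ) ≤ cumReal c s := by
    simpa [cumReal, cumWeight] using cumReal_mono c (Nat.zero_le s)
  set n := stageExp s
  -- The ceiling of `cumReal c s * 2 ^ (n + 1)`.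
  set m := (cumWeight c s * 2 ^ (n + 1) + (2 ^ s - 1)) / 2 ^ s with hm
  have hpos : 0 < 2 ^ s := by positivity
  have hdm := Nat.div_add_mod (cumWeight c s * 2 ^ (n + 1) + (2 ^ s - 1)) (2 ^ s)
  have hmod := Nat.mod_lt (cumWeight c s * 2 ^ (n + 1) + (2 ^ s - 1)) hpos
  rw [← hm, mul_comm] at hdm
  have m1 : cumWeight c s * 2 ^ (n + 1) ≤ m * 2 ^ s := by omega
  have m2 : m * 2 ^ s < cumWeight c s * 2 ^ (n + 1) + 2 ^ s := by omega
  have hlow : 2 ^ s ≤ cumWeight c s := by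
    rw [cumReal, one_le_div hp] at h0
    exact_mod_cast h0
  have hhigh : (cumWeight c s + 2 ^ s / 2 ^ n : ℝ) ≤ 2 * 2 ^ s := by
    rw [cumReal_succ, if_pos hr, cumReal, one_div, inv_pow] at h
    have := mul_le_mul_of_nonneg_right h hp.le
    rw [add_mul, div_mul_cancel₀ _ hp.ne'] at this
    rw [div_eq_inv_mul]
    exact this
  have hhigh' : cumWeight c s * 2 ^ (n + 1) + 2 * 2 ^ s ≤ 2 ^ (n + 2) * 2 ^ s := by
    have := mul_le_mul_of_nonneg_right hhigh (by positivity : (0 : ℝ) ≤ 2 ^ (n + 1))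
    have e : ((cumWeight c s : ℝ) + 2 ^ s / 2 ^ n) * 2 ^ (n + 1) =
        cumWeight c s * 2 ^ (n + 1) + 2 * 2 ^ s := by
      rw [pow_succ]; field_simp
    have e' : (2 * 2 ^ s * 2 ^ (n + 1) : ℝ) = 2 ^ (n + 2) * 2 ^ s := by ring
    rw [e, e'] at this
    exact_mod_cast this
  obtain ⟨w, hw, hv⟩ := exists_strVal_eq (n + 1) m
    (Nat.le_of_mul_le_mul_right (by
      calc 2 ^ (n + 1) * 2 ^ s ≤ cumWeight c s * 2 ^ (n + 1) := by
            rw [mul_comm]; exact Nat.mul_le_mul_right _ hlow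
        _ ≤ m * 2 ^ s := m1) hpos)
    (Nat.lt_of_mul_lt_mul_right (a := 2 ^ s) (by show m * 2 ^ s < 2 ^ (n + 2) * 2 ^ s; omega))
  exact ⟨w, hr, hw, by rw [hv]; exact m1, by rw [hv]; exact m2⟩

/-! ### Requests of a machine that computes a function -/

theorem ComputesReal.stageRun_value {i : ℕ} {g : List Bool → ℝ} (h : ComputesReal i g)
    (hg : ∀ x, 0 ≤ g x) {x : List Bool} {s t r : ℕ} (hs : s.unpair.1 = encode x)
    (hrun : stageRun (Denumerable.ofNat Code i) s t = some r) :
    0 < r.unpair.1.unpair.2 ∧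
      |(r.unpair.1.unpair.1 : ℝ) / r.unpair.1.unpair.2 - g x| < (1 / 2) ^ stageExp s := by
  obtain ⟨p, q, b, hmem, hq, habs, -⟩ := h x (2 ^ stageExp s) (by positivity)
  have hr := Code.evaln_sound hrun
  rw [hs] at hr
  have heq : r = encode ((p, q), b) := Part.mem_unique hr hmem
  subst heq
  rw [abs_of_nonneg (hg x)] at habs
  simpa [hq] using habs

theorem ComputesReal.lt_of_isRequest {i : ℕ} {g : List Bool → ℝ} (h : ComputesReal i g)
    (hg : ∀ x, 0 ≤ g x) {x : List Bool} {s : ℕ} (hs : s.unpair.1 = encode x)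
    (hr : IsRequest (Denumerable.ofNat Code i) s) : 2 * (1 / 2) ^ stageExp s < g x := by
  obtain ⟨-, -, h3, h4⟩ := hr
  obtain ⟨r, hrun⟩ := Option.isSome_iff_exists.1 h3
  obtain ⟨hq, habs⟩ := h.stageRun_value hg hs hrun
  rw [hrun, Option.getD_some] at h4
  set p := r.unpair.1.unpair.1
  set q := r.unpair.1.unpair.2
  have hq' : (0 : ℝ) < q := by exact_mod_cast hq
  have h4' : (3 * q : ℝ) ≤ p * 2 ^ stageExp s := by exact_mod_cast h4
  have : 3 * (1 / 2 : ℝ) ^ stageExp s ≤ p / q := by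
    rw [le_div_iff₀ hq', one_div, inv_pow]
    field_simp
    linarith
  linarith [(abs_lt.1 habs).2]

theorem ComputesReal.exists_isRequest {i : ℕ} {g : List Bool → ℝ} (h : ComputesReal i g)
    (hg : ∀ x, 0 ≤ g x) {x : List Bool} {n : ℕ} (hn : 4 * (1 / 2) ^ n ≤ g x) :
    ∃ s : ℕ, s.unpair.1 = encode x ∧ stageExp s = n ∧
      IsRequest (Denumerable.ofNat Code i) s := by
  classical
  obtain ⟨_, _, _, hmem, -, -, -⟩ := h x (2 ^ n) (by positivity)
  obtain ⟨T, hT⟩ := Code.evaln_complete.1 hmem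
  set c := Denumerable.ofNat Code i
  let run : ℕ → Option ℕ := fun t => c.evaln t (Nat.pair (encode x) (2 ^ n))
  have hex : ∃ t, (run t).isSome := ⟨T, Option.isSome_iff_exists.2 ⟨_, hT⟩⟩
  have hzero : run 0 = none := by simp [run, Code.evaln]
  -- The request is made at the first step `t + 1` at which the run has halted.
  obtain ⟨t, ht⟩ : ∃ t, Nat.find hex = t + 1 := by
    refine Nat.exists_eq_succ_of_ne_zero fun h0 => ?_
    have := Nat.find_spec hex
    rw [h0, hzero] at this
    simp at this
  have hmin : run t = none := by
    simpa using Nat.find_min hex (show t < Nat.find hex by omega)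
  have hspec : (run (t + 1)).isSome := ht ▸ Nat.find_spec hex
  set s := Nat.pair (encode x) (Nat.pair n t) with hs
  have hs1 : s.unpair.1 = encode x := by simp [hs]
  have hsn : stageExp s = n := by simp [hs, stageExp]
  have hst : s.unpair.2.unpair.2 = t := by simp [hs]
  have hrun : ∀ u, stageRun c s u = run u := fun u => by simp only [stageRun, hs1, hsn, run]
  refine ⟨s, hs1, hsn, by rw [hs1, encodek, encode_some], by rw [hst, hrun, hmin],
    by rw [hst, hrun, hspec], ?_⟩
  obtain ⟨r, hr⟩ := Option.isSome_iff_exists.1 hspec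
  rw [hst, hrun, hr, Option.getD_some]
  obtain ⟨hq, habs⟩ := h.stageRun_value hg hs1 ((hrun (t + 1)).trans hr)
  rw [hsn] at habs ⊢
  set p := r.unpair.1.unpair.1
  set q := r.unpair.1.unpair.2
  have hq' : (0 : ℝ) < q := by exact_mod_cast hq
  have : 3 * (1 / 2 : ℝ) ^ n ≤ p / q := by linarith [(abs_lt.1 habs).1]
  rw [le_div_iff₀ hq', one_div, inv_pow] at this
  field_simp at this
  have h' : (3 * q : ℝ) ≤ p * 2 ^ n := by linarith
  exact_mod_cast h'

/-! ### The total weight of the requests -/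

/-- The weight `2 ^ (-n)` of the request at stage `s`, and zero if there is none. -/
noncomputable def weight (c : Code) (s : ℕ) : ℝ≥0∞ :=
  if IsRequest c s then 2⁻¹ ^ stageExp s else 0

theorem ofReal_half_pow (n : ℕ) : ENNReal.ofReal ((1 / 2) ^ n) = 2⁻¹ ^ n := by
  rw [ENNReal.ofReal_pow (by norm_num), one_div, ENNReal.ofReal_inv_of_pos (by norm_num),
    ENNReal.ofReal_ofNat]

/-- The sum is dominated by the geometric series starting at the least `n` with `P n`. -/
theorem tsum_pow_le_of_lt (a : ℝ) (P : ℕ → Prop) [DecidablePred P]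
    (hP : ∀ n, P n → 2 * (1 / 2) ^ n < a) :
    ∑' n, (if P n then (2⁻¹ : ℝ≥0∞) ^ n else 0) ≤ ENNReal.ofReal a := by
  by_cases hex : ∃ n, P n
  · set n₀ := Nat.find hex
    have hlt : ∀ n < n₀, ¬ P n := fun n hn => Nat.find_min hex hn
    calc ∑' n, (if P n then (2⁻¹ : ℝ≥0∞) ^ n else 0)
        = ∑' n, (if P (n + n₀) then (2⁻¹ : ℝ≥0∞) ^ (n + n₀) else 0) := by
          refine ((add_left_injective n₀).tsum_eq fun n hn => ?_).symm
          refine ⟨n - n₀, Nat.sub_add_cancel (le_of_not_gt fun h => ?_)⟩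
          simp [hlt n h] at hn
      _ ≤ ∑' n, (2⁻¹ : ℝ≥0∞) ^ n * 2⁻¹ ^ n₀ := by
          refine ENNReal.tsum_le_tsum fun n => ?_
          rw [← pow_add]
          split_ifs
          · exact le_rfl
          · exact zero_le
      _ = 2 * 2⁻¹ ^ n₀ := by
          rw [ENNReal.tsum_mul_right, ENNReal.tsum_geometric, ENNReal.one_sub_inv_two, inv_inv]
      _ = ENNReal.ofReal (2 * (1 / 2) ^ n₀) := by
          rw [ENNReal.ofReal_mul (by norm_num), ofReal_half_pow, ENNReal.ofReal_ofNat]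
      _ ≤ ENNReal.ofReal a := ENNReal.ofReal_le_ofReal (hP n₀ (Nat.find_spec hex)).le
  · push Not at hex
    simp [hex]

open Classical in
/-- For given string and precision, at most one number of steps gives a request. -/
theorem tsum_weight_steps_le (c : Code) (k n : ℕ) :
    ∑' t, weight c (Nat.pair k (Nat.pair n t)) ≤
      if ∃ t, IsRequest c (Nat.pair k (Nat.pair n t)) then (2⁻¹ : ℝ≥0∞) ^ n else 0 := by
  have hrun : ∀ t u, stageRun c (Nat.pair k (Nat.pair n t)) u =
      c.evaln u (Nat.pair k (2 ^ n)) := fun t u => by simp [stageRun, stageExp]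
  have hlt : ∀ t t', t < t' → IsRequest c (Nat.pair k (Nat.pair n t)) →
      ¬ IsRequest c (Nat.pair k (Nat.pair n t')) := by
    intro t t' htt h h'
    obtain ⟨r, hr⟩ := Option.isSome_iff_exists.1 h.2.2.1
    have h2 := h'.2.1
    simp only [Nat.unpair_pair, hrun] at hr h2
    have := Code.evaln_mono (Nat.succ_le_of_lt htt) hr
    rw [Option.mem_def, h2] at this
    cases this
  split_ifs with hex
  · obtain ⟨t₀, h₀⟩ := hex
    rw [tsum_eq_single t₀]
    · simp [weight, h₀, stageExp]
    · intro t ht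
      rw [weight, if_neg]
      intro h
      rcases lt_or_gt_of_ne ht with hl | hl
      · exact hlt _ _ hl h h₀
      · exact hlt _ _ hl h₀ h
  · push Not at hex
    simp [weight, hex]

/-- The requests for `x` have total weight at most `g x`, since their weights are distinct powers
of one half below `g x / 2`. -/
theorem ComputesReal.tsum_weight_le {i : ℕ} {g : List Bool → ℝ} (h : ComputesReal i g)
    (hg : ∀ x, 0 ≤ g x) :
    ∑' s, weight (Denumerable.ofNat Code i) s ≤ ∑' x, ENNReal.ofReal (g x) := by
  classical
  set c := Denumerable.ofNat Code i
  calc ∑' s, weight c s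
      = ∑' k, ∑' m, weight c (Nat.pair k m) := by
        rw [← ENNReal.tsum_prod, ← Nat.pairEquiv.tsum_eq]
        rfl
    _ = ∑' x : List Bool, ∑' m, weight c (Nat.pair (encode x) m) := by
        refine (encode_injective.tsum_eq (f := fun k => ∑' m, weight c (Nat.pair k m))
          fun k hk => ?_).symm
        by_contra hne
        refine hk (ENNReal.tsum_eq_zero.2 fun m => if_neg fun hr => hne ?_)
        have h1 := hr.1
        rw [Nat.unpair_pair] at h1
        rcases hd : decode (α := List Bool) k with _ | x
        · rw [hd] at h1
          simp at h1
        · rw [hd, encode_some] at h1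
          exact ⟨x, Nat.succ_injective h1⟩
    _ = ∑' x : List Bool, ∑' n, ∑' t, weight c (Nat.pair (encode x) (Nat.pair n t)) := by
        refine tsum_congr fun x => ?_
        rw [← ENNReal.tsum_prod (f := fun n t => weight c (Nat.pair (encode x) (Nat.pair n t))),
          ← Nat.pairEquiv.tsum_eq]
        rfl
    _ ≤ ∑' x, ENNReal.ofReal (g x) := by
        refine ENNReal.tsum_le_tsum fun x => ?_
        refine (ENNReal.tsum_le_tsum fun n => tsum_weight_steps_le c (encode x) n).trans ?_
        refine tsum_pow_le_of_lt (g x) _ fun n ⟨t, ht⟩ => ?_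
        simpa [stageExp] using h.lt_of_isRequest hg (x := x) (by simp) ht

/-- The bound is two since `cumReal` starts at one. -/
theorem cumReal_le_two {c : Code} (h : ∑' s, weight c s ≤ 1) (s : ℕ) : cumReal c s ≤ 2 := by
  have key : ENNReal.ofReal (cumReal c s - 1) = ∑ r ∈ Finset.range s, weight c r := by
    induction s with
    | zero => simp [cumReal, cumWeight]
    | succ s ih =>
      have h0 : (1 : ℝ) ≤ cumReal c s := by
        simpa [cumReal, cumWeight] using cumReal_mono c (Nat.zero_le s)
      rw [Finset.sum_range_succ, ← ih, cumReal_succ, add_sub_right_comm,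
        ENNReal.ofReal_add (by linarith) (by split_ifs <;> positivity), weight]
      congr 1
      split_ifs
      · exact ofReal_half_pow _
      · exact ENNReal.ofReal_zero
  have h1 : ENNReal.ofReal (cumReal c s - 1) ≤ 1 := by
    rw [key]
    exact (ENNReal.sum_le_tsum _).trans h
  rw [ENNReal.ofReal_le_one] at h1
  linarith

theorem ofReal_mass (f : PMF (List Bool)) (x : List Bool) : ENNReal.ofReal (mass f x) = f x :=
  ENNReal.ofReal_toReal (f.apply_ne_top x)

theorem mass_le_one (f : PMF (List Bool)) (x : List Bool) : mass f x ≤ 1 :=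
  ENNReal.toReal_le_of_le_ofReal zero_le_one (by simpa using f.coe_le_one x)

/-- A machine computing the mass function `f` yields for every `x` in the support a code word of
length at most `log (1 / f x) + 4`. -/
theorem exists_short_codeWord {i : ℕ} {f : PMF (List Bool)} (h : ComputesReal i (mass f))
    {x : List Bool} (hx : f x ≠ 0) :
    ∃ s w, IsCodeWord (Denumerable.ofNat Code i) s w ∧ s.unpair.1 = encode x ∧
      (w.length : ℝ) ≤ Real.logb 2 (1 / mass f x) + 4 := by
  classical
  have hpos : 0 < mass f x := ENNReal.toReal_pos hx (f.apply_ne_top x)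
  have hle := mass_le_one f x
  have hex : ∃ n : ℕ, 4 * (1 / 2 : ℝ) ^ n ≤ mass f x := by
    obtain ⟨n, hn⟩ := exists_pow_lt_of_lt_one (show 0 < mass f x / 4 by positivity)
      (show (1 / 2 : ℝ) < 1 by norm_num)
    exact ⟨n, by linarith⟩
  -- The least admissible `n` is positive because `mass f x ≤ 1`; its predecessor `m` violates the
  -- bound, so `m < log (4 / f x)`, and the code word has length `n + 1 = m + 2`.
  obtain ⟨m, hm⟩ : ∃ m, Nat.find hex = m + 1 := by
    refine Nat.exists_eq_succ_of_ne_zero fun h0 => ?_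
    have := Nat.find_spec hex
    rw [h0, pow_zero] at this
    linarith
  obtain ⟨s, hs, hn, hr⟩ := h.exists_isRequest (fun _ => ENNReal.toReal_nonneg)
    (Nat.find_spec hex)
  have htot := h.tsum_weight_le (fun _ => ENNReal.toReal_nonneg)
  simp only [ofReal_mass, f.tsum_coe] at htot
  obtain ⟨w, hw⟩ := exists_isCodeWord hr (cumReal_le_two htot _)
  refine ⟨s, w, hw, hs, ?_⟩
  have hmin := Nat.find_min hex (show m < Nat.find hex by omega)
  rw [not_le, one_div, inv_pow, ← div_eq_mul_inv, lt_div_iff₀ (by positivity)] at hmin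
  have hlog : (m : ℝ) - 2 ≤ Real.logb 2 (1 / mass f x) := by
    rw [Real.le_logb_iff_rpow_le one_lt_two (by positivity), Real.rpow_sub two_pos,
      Real.rpow_natCast, Real.rpow_ofNat, div_le_div_iff₀ (by norm_num) hpos]
    linarith
  rw [hw.2.1, hn, hm]
  push_cast
  linarith

/-! ### Complexity: finiteness, Kraft's inequality, and the coding bound -/

theorem K_le_length {U : List Bool →. List Bool} {x z : List Bool} (h : x ∈ U z) :
    K U x ≤ z.length := iInf₂_le z h

theorem exists_program_of_K_ne_top {U : List Bool →. List Bool} {x : List Bool}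
    (h : K U x ≠ ⊤) : ∃ z, x ∈ U z ∧ (z.length : ℕ∞) = K U x := by
  rw [K, iInf_subtype'] at h ⊢
  have hne : Nonempty {z // x ∈ U z} := by
    by_contra hempty
    rw [not_nonempty_iff] at hempty
    exact h (iInf_of_empty _)
  obtain ⟨⟨z, hz⟩, hz'⟩ := ENat.exists_eq_iInf fun z : {z // x ∈ U z} => (z.1.length : ℕ∞)
  exact ⟨z, hz, hz'⟩

theorem IsUniversalPrefixMachine.exists_K_le {U : List Bool →. List Bool}
    (hU : IsUniversalPrefixMachine U) {T : List Bool →. List Bool} (hT : IsPrefixMachine T) :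
    ∃ c : ℕ, ∀ x y, x ∈ T y → K U x ≤ y.length + c := by
  obtain ⟨e, c, hlen, he⟩ := hU.simulates T hT
  refine ⟨c, fun x y hx => ?_⟩
  rw [← he y] at hx
  exact (K_le_length hx).trans (by exact_mod_cast hlen y)

theorem IsUniversalPrefixMachine.K_ne_top {U : List Bool →. List Bool}
    (hU : IsUniversalPrefixMachine U) (x : List Bool) : K U x ≠ ⊤ := by
  obtain ⟨T, hT, hmem⟩ := exists_prefixMachine (α := Unit) (fun p => p.2 = ([], x))
    (Primrec.eq.comp Primrec.snd (Primrec.const _)) (by simp +contextual)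
  obtain ⟨c, hc⟩ := hU.exists_K_le hT
  exact ne_top_of_le_ne_top (ENat.natCast_ne_top (0 + c))
    (by simpa using hc x [] ((hmem _ _).2 ⟨(), rfl⟩))

/-- Nonempty words of a prefix-free set can be read off from the left. -/
theorem uniquelyDecodable_of_prefixFree {S : Set (List Bool)} (hnil : [] ∉ S)
    (hS : ∀ u ∈ S, ∀ v ∈ S, u <+: v → u = v) : InformationTheory.UniquelyDecodable S := by
  intro L₁
  induction L₁ with
  | nil =>
    intro L₂ _ h₂ h
    rcases L₂ with _ | ⟨v, L₂⟩
    · rfl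
    · have hv : v = [] := by
        simp only [List.flatten_nil, List.flatten_cons] at h
        exact (List.append_eq_nil_iff.1 h.symm).1
      exact absurd (hv ▸ h₂ v List.mem_cons_self) hnil
  | cons u L₁ ih =>
    intro L₂ h₁ h₂ h
    have hu := h₁ u List.mem_cons_self
    rcases L₂ with _ | ⟨v, L₂⟩
    · have hu' : u = [] := by
        simp only [List.flatten_nil, List.flatten_cons] at h
        exact (List.append_eq_nil_iff.1 h).1
      exact absurd (hu' ▸ hu) hnil
    · have hv := h₂ v List.mem_cons_self
      simp only [List.flatten_cons] at h
      have huv : u = v := by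
        rcases List.prefix_or_prefix_of_prefix (List.prefix_append u L₁.flatten)
          (h ▸ List.prefix_append v L₂.flatten) with hp | hp
        · exact hS u hu v hv hp
        · exact (hS v hv u hu hp).symm
      subst huv
      rw [ih L₂ (fun w hw => h₁ w (List.mem_cons_of_mem _ hw))
        (fun w hw => h₂ w (List.mem_cons_of_mem _ hw)) (List.append_cancel_left h)]

/-- Kraft's inequality for prefix-free sets, including `{[]}`, which is not uniquely decodable. -/
theorem sum_pow_length_le_one_of_prefixFree (S : Finset (List Bool))
    (hS : ∀ u ∈ S, ∀ v ∈ S, u <+: v → u = v) : ∑ w ∈ S, (1 / 2 : ℝ) ^ w.length ≤ 1 := by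
  by_cases hnil : [] ∈ S
  · have : S = {[]} := Finset.eq_singleton_iff_unique_mem.2
      ⟨hnil, fun v hv => (hS [] hnil v hv List.nil_prefix).symm⟩
    simp [this]
  · simpa using InformationTheory.kraft_mcmillan_inequality
      (uniquelyDecodable_of_prefixFree (S := (S : Set (List Bool))) (by simpa using hnil)
        (by simpa using hS))

theorem IsUniversalPrefixMachine.tsum_pow_K_le_one {U : List Bool →. List Bool}
    (hU : IsUniversalPrefixMachine U) : ∑' x, (2⁻¹ : ℝ≥0∞) ^ (K U x).toNat ≤ 1 := by
  classical
  choose z hz hlen using fun x => exists_program_of_K_ne_top (hU.K_ne_top x)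
  have hinj : Function.Injective z := fun x y hxy => by
    have h := hz x
    rw [hxy] at h
    exact Part.mem_unique h (hz y)
  rw [ENNReal.tsum_eq_iSup_sum]
  refine iSup_le fun A => ?_
  have hk := sum_pow_length_le_one_of_prefixFree (A.image z) (by
    intro u hu v hv huv
    obtain ⟨x, -, rfl⟩ := Finset.mem_image.1 hu
    obtain ⟨y, -, rfl⟩ := Finset.mem_image.1 hv
    exact hU.isPrefixMachine.prefixFree _ _ (Part.dom_iff_mem.2 ⟨x, hz x⟩)
      (Part.dom_iff_mem.2 ⟨y, hz y⟩) huv)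
  rw [Finset.sum_image hinj.injOn] at hk
  calc ∑ x ∈ A, (2⁻¹ : ℝ≥0∞) ^ (K U x).toNat
      = ENNReal.ofReal (∑ x ∈ A, (1 / 2 : ℝ) ^ (z x).length) := by
        rw [ENNReal.ofReal_sum_of_nonneg fun _ _ => by positivity]
        refine Finset.sum_congr rfl fun x _ => ?_
        rw [← hlen x, ENat.toNat_natCast, ofReal_half_pow]
    _ ≤ 1 := ENNReal.ofReal_le_one.2 hk

/-- The term of Gibbs' inequality for `a` against `2 ^ (-k)`, with `log u ≤ u - 1` made additive to
avoid subtraction in `[0, ∞]`. -/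
theorem gibbs_term (a : ℝ) (h₀ : 0 ≤ a) (h₁ : a ≤ 1) (k : ℕ) :
    ENNReal.ofReal a * ENNReal.ofReal (Real.logb 2 (1 / a)) +
        ENNReal.ofReal a * ENNReal.ofReal (1 / Real.log 2) ≤
      ENNReal.ofReal a * k + 2⁻¹ ^ k * ENNReal.ofReal (1 / Real.log 2) := by
  rcases h₀.eq_or_lt with rfl | hpos
  · simp
  have hlog2 : 0 < Real.log 2 := Real.log_pos one_lt_two
  have hlogb : 0 ≤ Real.logb 2 (1 / a) :=
    Real.logb_nonneg one_lt_two (by rw [le_div_iff₀ hpos]; linarith)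
  rw [← ofReal_half_pow, ← ENNReal.ofReal_natCast k, ← ENNReal.ofReal_mul h₀,
    ← ENNReal.ofReal_mul h₀,
    ← ENNReal.ofReal_mul h₀, ← ENNReal.ofReal_mul (by positivity),
    ← ENNReal.ofReal_add (by positivity) (by positivity),
    ← ENNReal.ofReal_add (by positivity) (by positivity)]
  refine ENNReal.ofReal_le_ofReal ?_
  have key := Real.log_le_sub_one_of_pos (show 0 < (1 / 2 : ℝ) ^ k / a by positivity)
  rw [Real.log_div (by positivity) hpos.ne', Real.log_pow, one_div, Real.log_inv] at key
  have key' := mul_le_mul_of_nonneg_left key h₀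
  rw [mul_sub a _ 1, mul_div_cancel₀ _ hpos.ne'] at key'
  rw [Real.logb, one_div a, Real.log_inv, ← sub_nonneg]
  have e : a * k + (1 / 2) ^ k * (1 / Real.log 2) -
      (a * (-Real.log a / Real.log 2) + a * (1 / Real.log 2)) =
      (a * (k * Real.log 2) + 2⁻¹ ^ k + a * Real.log a - a) / Real.log 2 := by
    rw [one_div (2 : ℝ)]
    field_simp
    ring
  rw [e]
  exact div_nonneg (by linarith) hlog2.le

theorem IsUniversalPrefixMachine.coe_toNat_K {U : List Bool →. List Bool}
    (hU : IsUniversalPrefixMachine U) (x : List Bool) :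
    (((K U x).toNat : ℕ) : ℝ≥0∞) = (K U x : ℝ≥0∞) := by
  conv_rhs => rw [← ENat.natCast_toNat (hU.K_ne_top x)]
  rfl

/-- Summing the terms of Gibbs' inequality gives `H + c ≤ ∑ f K + c ∑ 2 ^ (-K)` with
`c = 1 / log 2`, and the last sum is at most one by Kraft's inequality. -/
theorem entropy_le_expectedK {U : List Bool →. List Bool} (hU : IsUniversalPrefixMachine U)
    (f : PMF (List Bool)) : entropy f ≤ expectedK U f := by
  set c := ENNReal.ofReal (1 / Real.log 2) with hc
  have hterm : ∀ x, f x * ENNReal.ofReal (Real.logb 2 (1 / mass f x)) + f x * c ≤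
      f x * (K U x : ℝ≥0∞) + 2⁻¹ ^ (K U x).toNat * c := fun x => by
    have := gibbs_term (mass f x) ENNReal.toReal_nonneg (mass_le_one f x) (K U x).toNat
    rwa [ofReal_mass, hU.coe_toNat_K] at this
  have hsum := ENNReal.tsum_le_tsum hterm
  rw [ENNReal.tsum_add, ENNReal.tsum_add, ENNReal.tsum_mul_right, ENNReal.tsum_mul_right,
    f.tsum_coe, one_mul] at hsum
  refine (ENNReal.add_le_add_iff_right (ENNReal.ofReal_ne_top (r := 1 / Real.log 2))).1
    (hsum.trans ?_)
  exact add_le_add_right (mul_le_of_le_one_left zero_le hU.tsum_pow_K_le_one) _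

/-- The decoder: a program for the string of the index `i` followed by a code word for machine `i`
is a program for the string that the code word stands for. -/
theorem exists_decoder {U : List Bool →. List Bool} (hU : IsPrefixMachine U) :
    ∃ T, IsPrefixMachine T ∧ ∀ (i : ℕ) (z w x : List Bool) (s : ℕ), natToString i ∈ U z →
      IsCodeWord (Denumerable.ofNat Code i) s w → s.unpair.1 = encode x → x ∈ T (z ++ w) := by
  obtain ⟨cU, hcU⟩ := Code.exists_code.1 hU.partrec
  have hU' : ∀ z v, v ∈ U z ↔ ∃ t, cU.evaln t (encode z) = some (encode v) := by
    intro z v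
    have h := Code.evaln_complete (c := cU) (n := encode z) (x := encode v)
    rw [hcU] at h
    simpa using h
  -- A witness `(t, z, v, s, w)` records that `U` halts on `z` with output `v` within `t` steps and
  -- that `w` is the code word of stage `s` of the machine whose index has the string `v`.
  let R : (ℕ × List Bool × List Bool × ℕ × List Bool) × List Bool × List Bool → Prop := fun p =>
    p.2.1 = p.1.2.1 ++ p.1.2.2.2.2 ∧
    cU.evaln p.1.1 (encode p.1.2.1) = some (encode p.1.2.2.1) ∧
    IsCodeWord (Denumerable.ofNat Code (strVal p.1.2.2.1 - 1)) p.1.2.2.2.1 p.1.2.2.2.2 ∧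
    p.1.2.2.2.1.unpair.1 = encode p.2.2
  have hR : PrimrecPred R := by
    have h1 : Primrec fun p :
        (ℕ × List Bool × List Bool × ℕ × List Bool) × List Bool × List Bool => p.1.2 :=
      Primrec.snd.comp Primrec.fst
    have hz := Primrec.fst.comp h1
    have h2 := Primrec.snd.comp h1
    have hv := Primrec.fst.comp h2
    have h3 := Primrec.snd.comp h2
    have hs := Primrec.fst.comp h3
    have hw := Primrec.snd.comp h3
    refine PrimrecPred.and ?_ (PrimrecPred.and ?_ (PrimrecPred.and ?_ ?_))
    · exact Primrec.eq.comp (Primrec.fst.comp Primrec.snd) (Primrec.list_append.comp hz hw)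
    · exact Primrec.eq.comp
        (Code.primrec_evaln.comp (((Primrec.fst.comp Primrec.fst).pair (Primrec.const cU)).pair
          (Primrec.encode.comp hz)))
        (Primrec.option_some.comp (Primrec.encode.comp hv))
    · exact isCodeWord_primrec.comp (((Primrec.ofNat Code).comp
        (Primrec.pred.comp (strVal_primrec.comp hv))).pair (hs.pair hw))
    · exact Primrec.eq.comp (unpair_fst_primrec.comp hs)
        (Primrec.encode.comp (Primrec.snd.comp Primrec.snd))
  obtain ⟨T, hT, hmem⟩ := exists_prefixMachine R hR (by
    rintro ⟨t, z, v, s, w⟩ y x ⟨t', z', v', s', w'⟩ y' x'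
      ⟨hy, hv, hw, hx⟩ ⟨hy', hv', hw', hx'⟩ hp
    dsimp only at *
    subst hy hy'
    have hvU := (hU' z v).2 ⟨t, hv⟩
    have hvU' := (hU' z' v').2 ⟨t', hv'⟩
    have hzz : z = z' := by
      rcases List.prefix_or_prefix_of_prefix ((List.prefix_append z w).trans hp)
        (List.prefix_append z' w') with h | h
      · exact hU.prefixFree _ _ (Part.dom_iff_mem.2 ⟨v, hvU⟩) (Part.dom_iff_mem.2 ⟨v', hvU'⟩) h
      · exact (hU.prefixFree _ _ (Part.dom_iff_mem.2 ⟨v', hvU'⟩)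
          (Part.dom_iff_mem.2 ⟨v, hvU⟩) h).symm
    subst hzz
    obtain rfl := Part.mem_unique hvU hvU'
    obtain ⟨rfl, rfl⟩ := hw.eq_of_prefix hw' ((List.prefix_append_right_inj z).1 hp)
    exact ⟨rfl, encode_injective (hx.symm.trans hx')⟩)
  refine ⟨T, hT, fun i z w x s hz hw hx => ?_⟩
  obtain ⟨t, ht⟩ := (hU' z _).1 hz
  refine (hmem _ _).2 ⟨(t, z, natToString i, s, w), rfl, ht, ?_, hx⟩
  rw [strVal_natToString]
  exact hw

/-- The coding bound holds pointwise on the support, not only in expectation: prefix a shortest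
program for a machine computing `f` to the code word of `x` and run the decoder. -/
theorem exists_K_le_log_add {U : List Bool →. List Bool} (hU : IsUniversalPrefixMachine U) :
    ∃ C : ℕ, ∀ (f : PMF (List Bool)) (x : List Bool), f x ≠ 0 →
      (K U x : ℝ≥0∞) ≤ ENNReal.ofReal (Real.logb 2 (1 / mass f x)) +
        (KReal U (mass f) : ℝ≥0∞) + C := by
  obtain ⟨T, hT, hdec⟩ := exists_decoder hU.isPrefixMachine
  obtain ⟨c, hc⟩ := hU.exists_K_le hT
  refine ⟨c + 4, fun f x hx => ?_⟩
  by_cases htop : KReal U (mass f) = ⊤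
  · simp [htop]
  obtain ⟨i, hi, hK⟩ : ∃ i, ComputesReal i (mass f) ∧ K U (natToString i) = KReal U (mass f) := by
    rw [KReal, iInf_subtype'] at htop ⊢
    have hne : Nonempty {i // ComputesReal i (mass f)} := by
      by_contra hempty
      rw [not_nonempty_iff] at hempty
      exact htop (iInf_of_empty _)
    obtain ⟨⟨i, hi⟩, hi'⟩ := ENat.exists_eq_iInf
      fun i : {i // ComputesReal i (mass f)} => K U (natToString i)
    exact ⟨i, hi, hi'⟩
  obtain ⟨z, hz, hzlen⟩ := exists_program_of_K_ne_top (hU.K_ne_top (natToString i))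
  obtain ⟨s, w, hw, hs, hwlen⟩ := exists_short_codeWord hi hx
  have hbound := hc x (z ++ w) (hdec i z w x s hz hw hs)
  have hw' : (w.length : ℝ≥0∞) ≤ ENNReal.ofReal (Real.logb 2 (1 / mass f x)) + 4 := by
    have hpos : 0 < mass f x := ENNReal.toReal_pos hx (f.apply_ne_top x)
    have hlogb : 0 ≤ Real.logb 2 (1 / mass f x) := Real.logb_nonneg one_lt_two
      (by rw [le_div_iff₀ hpos, one_mul]; exact mass_le_one f x)
    rw [← ENNReal.ofReal_natCast, ← ENNReal.ofReal_ofNat 4, ← ENNReal.ofReal_add hlogb (by simp)]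
    exact ENNReal.ofReal_le_ofReal hwlen
  have hbound' : (K U x : ℝ≥0∞) ≤ ((z.length + w.length + c : ℕ) : ℝ≥0∞) := by
    have : K U x ≤ ((z.length + w.length + c : ℕ) : ℕ∞) := by
      simpa [List.length_append] using hbound
    simpa using ENat.toENNReal_le.2 this
  have hzlen' : ((z.length : ℕ) : ℝ≥0∞) = (KReal U (mass f) : ℝ≥0∞) := by
    rw [← hK, ← hzlen]; rfl
  calc (K U x : ℝ≥0∞) ≤ (z.length : ℝ≥0∞) + w.length + c := by simpa using hbound'
    _ ≤ (KReal U (mass f) : ℝ≥0∞) + (ENNReal.ofReal (Real.logb 2 (1 / mass f x)) + 4) + c := by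
        rw [hzlen']; gcongr
    _ = _ := by push_cast; ring

theorem IsUniversalPrefixMachine.KReal_ne_top {U : List Bool →. List Bool}
    (hU : IsUniversalPrefixMachine U) {g : List Bool → ℝ} (hg : IsComputableReal g) :
    KReal U g ≠ ⊤ := by
  obtain ⟨i, hi⟩ := hg
  exact ne_top_of_le_ne_top (hU.K_ne_top (natToString i)) (iInf₂_le i hi)

end AlgInfo

theorem mainTheorem4 (U : List Bool →. List Bool) (hU : AlgInfo.IsUniversalPrefixMachine U) :
    ∃ C : ℕ, ∀ f : PMF (List Bool), AlgInfo.IsComputableReal (AlgInfo.mass f) →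
      AlgInfo.entropy f ≤ AlgInfo.expectedK U f ∧
      AlgInfo.expectedK U f ≤
        AlgInfo.entropy f + (AlgInfo.KReal U (AlgInfo.mass f) : ℝ≥0∞) + (C : ℝ≥0∞) ∧
      (AlgInfo.entropy f ≠ ⊤ →
        AlgInfo.expectedK U f ≠ ⊤ ∧ AlgInfo.KReal U (AlgInfo.mass f) ≠ ⊤ ∧
        0 ≤ (AlgInfo.expectedK U f).toReal - (AlgInfo.entropy f).toReal ∧
        (AlgInfo.expectedK U f).toReal - (AlgInfo.entropy f).toReal ≤
          ((AlgInfo.KReal U (AlgInfo.mass f)).toNat : ℝ) + (C : ℝ)) := by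
  obtain ⟨C, hC⟩ := AlgInfo.exists_K_le_log_add hU
  refine ⟨C, fun f hf => ?_⟩
  have hlow := AlgInfo.entropy_le_expectedK hU f
  have hfin := hU.KReal_ne_top hf
  have hup : AlgInfo.expectedK U f ≤
      AlgInfo.entropy f + (AlgInfo.KReal U (AlgInfo.mass f) : ℝ≥0∞) + (C : ℝ≥0∞) := by
    have hterm : ∀ x, f x * (AlgInfo.K U x : ℝ≥0∞) ≤
        f x * ENNReal.ofReal (Real.logb 2 (1 / AlgInfo.mass f x)) +
          f x * ((AlgInfo.KReal U (AlgInfo.mass f) : ℝ≥0∞) + C) := fun x => by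
      by_cases hx : f x = 0
      · simp [hx]
      · rw [← mul_add, ← add_assoc]
        gcongr
        exact hC f x hx
    have hsum := ENNReal.tsum_le_tsum hterm
    rw [ENNReal.tsum_add, ENNReal.tsum_mul_right, f.tsum_coe, one_mul, ← add_assoc] at hsum
    exact hsum
  refine ⟨hlow, hup, fun hH => ?_⟩
  obtain ⟨k, hk⟩ := ENat.ne_top_iff_exists.1 hfin
  rw [← hk] at hup ⊢
  have hup' : AlgInfo.expectedK U f ≤ AlgInfo.entropy f + (k : ℝ≥0∞) + (C : ℝ≥0∞) := hup
  have hE : AlgInfo.entropy f + (k : ℝ≥0∞) + (C : ℝ≥0∞) ≠ ⊤ := by simp [hH]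
  have hK : AlgInfo.expectedK U f ≠ ⊤ := ne_top_of_le_ne_top hE hup'
  refine ⟨hK, ENat.natCast_ne_top k, sub_nonneg.2 (ENNReal.toReal_mono hK hlow), ?_⟩
  have h := ENNReal.toReal_mono hE hup'
  rw [ENNReal.toReal_add (by simp [hH]) (by simp), ENNReal.toReal_add hH (by simp),
    ENNReal.toReal_natCast, ENNReal.toReal_natCast] at h
  rw [ENat.toNat_natCast]
  linarith
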